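/- Let $M$ and $M'$ be smooth manifolds without boundary with Riemannian metrics $g$, $g'$, and let $\mathcal F$, $\mathcal F'$ be smooth foliations on them with respect to which $g$ and $g'$ are bundle-like; let $M$ be connected and let $\mathcal F$ have codimension $q>2$. Let $Q=TM/T\mathcal F$ with projection $\pi:TM\to Q$, let $\sigma:Q\to T\mathcal F^{\perp}$ be the canonical isomorphism, let $g_Q=\sigma^*g$, and define $Q'$, $\pi'$, $g_{Q'}$ in the same way for $\mathcal F'$. Let $\nabla$ be the transverse Levi-Civita connection on $Q$: $\nabla_Xs=\pi[X,\sigma(s)]$ for $X$ tangent to $\mathcal F$, and $\nabla_Xs=\pi(\nabla^M_X\sigma(s))$ for $X$ orthogonal to $\mathcal F$, where $\nabla^M$ is the Levi-Civita connection of $(M,g)$. Let $\varphi:M\to M'$ be a smooth foliated map, i.e. $d\varphi(T\mathcal F)\subset T\mathcal F'$, and put $d_T\varphi=\pi'\circ d\varphi\circ\sigma:Q\to Q'$ and $(\varphi^*g_{Q'})(u,w)=g_{Q'}(d_T\varphi(u),d_T\varphi(w))$. The transversal stress-energy tensor is $$S_T(\varphi)=\tfrac12|d_T\varphi|^2g_Q-\varphi^*g_{Q'},$$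 where $|d_T\varphi|^2=\sum_a g_{Q'}(d_T\varphi(E_a),d_T\varphi(E_a))$, and its divergence is $(\mathrm{div}_\nabla S_T(\varphi))(u)=\sum_a(\nabla_{E_a}S_T(\varphi))(E_a,u)$, for $g_Q$-orthonormal $E_1,\dots,E_q$. The map $\varphi$ satisfies the transverse conservation law if $\mathrm{div}_\nabla S_T(\varphi)=0$ on $M$. A basic function is a smooth function constant along the leaves; $d_B$ is the exterior derivative on basic functions. Suppose that $\varphi$ is transversally weakly conformal: $\varphi^*g_{Q'}=\lambda^2g_Q$ for a function $\lambda:M\to\mathbb R$ such that $\lambda^2$ is basic. Then: 1. $\mathrm{div}_\nabla S_T(\varphi)=\frac{q-2}{2}\,d_B(\lambda^2)$. 2. $\varphi$ satisfies the transverse conservation law if and only if $\lambda^2$ is constant. 3. If $\varphi$ is not transversally constant (that is, $d_T\varphi$ does not vanish identically), then $\varphi$ is transversally homothetic, meaning $\varphi^*g_{Q'}=c^2g_Q$ for some constant $c\neq0$, if and only if $\varphi$ satisfies the transverse conservation law. -/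

import Mathlib

open Bundle Manifold Topology
open scoped ContDiff

noncomputable section

/-! ### Levi-Civita connection -/

section LeviCivita

variable {E : Type*} [NormedAddCommGroup E] [NormedSpace ℝ E]
  {H : Type*} [TopologicalSpace H] (I : ModelWithCorners ℝ E H)
  {M : Type*} [TopologicalSpace M] [ChartedSpace H M] [IsManifold I ∞ M]
  [RiemannianBundle (fun x : M ↦ TangentSpace I x)]

instance tangentSpaceFiniteDimensional [FiniteDimensional ℝ E] (x : M) :
    FiniteDimensional ℝ (TangentSpace I x) :=
  inferInstanceAs (FiniteDimensional ℝ E)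

/-- The right hand side of the Koszul formula, which equals `g(∇_X Y, Z)` at `x`:
`½ (X g(Y,Z) + Y g(Z,X) - Z g(X,Y) + g([X,Y],Z) - g([Y,Z],X) + g([Z,X],Y))`. -/
def koszul (X Y Z : Π x : M, TangentSpace I x) (x : M) : ℝ :=
  (1 / 2 : ℝ) *
    (mvfderiv I (fun y ↦ inner ℝ (Y y) (Z y)) x (X x)
      + mvfderiv I (fun y ↦ inner ℝ (Z y) (X y)) x (Y x)
      - mvfderiv I (fun y ↦ inner ℝ (X y) (Y y)) x (Z x)
      + inner ℝ (VectorField.mlieBracket I X Y x) (Z x)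
      - inner ℝ (VectorField.mlieBracket I Y Z x) (X x)
      + inner ℝ (VectorField.mlieBracket I Z X x) (Y x))

variable [FiniteDimensional ℝ E]

/-- The Levi-Civita connection of the Riemannian manifold `M`: the vector `(∇_v Y)(x)` for
`v ∈ T_x M` and a vector field `Y`, expanded in an orthonormal basis `(e_i)` of `T_x M`, with
coefficients `g(∇_v Y, e_i)` given by the Koszul formula. The vectors `v` and `e_i` are extended to
smooth local vector fields; the result does not depend on the extensions. -/
def leviCivita (Y : Π x : M, TangentSpace I x) (x : M) (v : TangentSpace I x) :
    TangentSpace I x :=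
  ∑ i, koszul I (FiberBundle.extend E v) Y
      (FiberBundle.extend E (stdOrthonormalBasis ℝ (TangentSpace I x) i)) x •
    stdOrthonormalBasis ℝ (TangentSpace I x) i

end LeviCivita

/-! ### Foliations -/

/-- A smooth foliation of codimension `q` on `M`: a field of tangent subspaces `T𝓕` which near
every point is the kernel of the differential of a smooth submersion to `ℝ^q` (the leaves are
locally the level sets of these submersions). -/
structure SmoothFoliation {E : Type*} [NormedAddCommGroup E] [NormedSpace ℝ E]
    {H : Type*} [TopologicalSpace H] (I : ModelWithCorners ℝ E H)
    (M : Type*) [TopologicalSpace M] [ChartedSpace H M] (q : ℕ) where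
  /-- the tangent bundle `T𝓕` of the foliation -/
  tangent : Π x : M, Submodule ℝ (TangentSpace I x)
  exists_submersion : ∀ x : M, ∃ U : Set M, IsOpen U ∧ x ∈ U ∧
    ∃ f : M → EuclideanSpace ℝ (Fin q),
      ContMDiffOn I 𝓘(ℝ, EuclideanSpace ℝ (Fin q)) ∞ f U ∧
      ∀ y ∈ U, Function.Surjective (mvfderiv I f y) ∧
        ∀ v : TangentSpace I y, v ∈ tangent y ↔ mvfderiv I f y v = 0

namespace SmoothFoliation

section Single

variable {E : Type*} [NormedAddCommGroup E] [NormedSpace ℝ E] [FiniteDimensional ℝ E]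
  {H : Type*} [TopologicalSpace H] {I : ModelWithCorners ℝ E H}
  {M : Type*} [TopologicalSpace M] [ChartedSpace H M] [IsManifold I ∞ M]
  [RiemannianBundle (fun x : M ↦ TangentSpace I x)]
  {q : ℕ} (F : SmoothFoliation I M q)

/-- The fibre `Q_x = T_x M / T_x 𝓕` of the normal bundle. -/
abbrev Normal (x : M) : Type _ := TangentSpace I x ⧸ F.tangent x

/-- The projection `π : TM → Q`. -/
def proj (x : M) : TangentSpace I x →ₗ[ℝ] F.Normal x := (F.tangent x).mkQ

/-- The canonical isomorphism `σ : Q → T𝓕^⊥ ⊆ TM`, inverse to the restriction of `π`. -/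
def lift (x : M) : F.Normal x →ₗ[ℝ] TangentSpace I x :=
  (F.tangent x)ᗮ.subtype ∘ₗ
    (Submodule.quotientEquivOfIsCompl (F.tangent x) (F.tangent x)ᗮ
      (Submodule.isCompl_orthogonal _)).toLinearMap

/-- The metric `g_Q = σ^* g` on the normal bundle. -/
def metricQ (x : M) (u w : F.Normal x) : ℝ := inner ℝ (F.lift x u) (F.lift x w)

/-- An orthonormal basis `E_a` of `(Q_x, g_Q)`. -/
def frame (x : M) (a : Fin (Module.finrank ℝ (F.tangent x)ᗮ)) : F.Normal x :=
  F.proj x (stdOrthonormalBasis ℝ (F.tangent x)ᗮ a : TangentSpace I x)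

/-- Smoothness at `x` of a section of `Q`. -/
def SmoothSectionAt (s : Π x : M, F.Normal x) (x : M) : Prop :=
  ContMDiffAt I (I.prod 𝓘(ℝ, E)) ∞
    (fun y ↦ (⟨y, F.lift y (s y)⟩ : TangentBundle I M)) x

/-- The transverse Lie derivative `L_X s = π [X, Y_s]` where `π(Y_s) = s`
(`X` a section of `T𝓕`). -/
def transverseLie (X : Π x : M, TangentSpace I x) (s : Π x : M, F.Normal x) (x : M) :
    F.Normal x :=
  F.proj x (VectorField.mlieBracket I X (fun y ↦ F.lift y (s y)) x)

/-- The metric of `M` is bundle-like: `g_Q` is holonomy invariant, that is `L_X g_Q = 0` for all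
local sections `X` of `T𝓕`. -/
def IsBundleLike : Prop :=
  ∀ (x : M) (X : Π x : M, TangentSpace I x) (s t : Π x : M, F.Normal x),
    ContMDiffAt I (I.prod 𝓘(ℝ, E)) ∞ (fun y ↦ (⟨y, X y⟩ : TangentBundle I M)) x →
    (∀ᶠ y in 𝓝 x, X y ∈ F.tangent y) →
    F.SmoothSectionAt s x → F.SmoothSectionAt t x →
    mvfderiv I (fun y ↦ F.metricQ y (s y) (t y)) x (X x)
      - F.metricQ x (F.transverseLie X s x) (t x)
      - F.metricQ x (s x) (F.transverseLie X t x) = 0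

/-- A basic function: a smooth function which is constant along the leaves. -/
def IsBasic (f : M → ℝ) : Prop :=
  ContMDiff I 𝓘(ℝ, ℝ) ∞ f ∧ ∀ (x : M), ∀ v ∈ F.tangent x, mvfderiv I f x v = 0

/-- The exterior derivative `d_B f` of a basic function, as a section of `Q^*`. -/
def dBasic (f : M → ℝ) (x : M) (u : F.Normal x) : ℝ := mvfderiv I f x (F.lift x u)

/-- A local extension of `u ∈ Q_x` to a section of `Q`, smooth near `x`. -/
def extendQ {x : M} (u : F.Normal x) (y : M) : F.Normal y :=
  F.proj y (FiberBundle.extend E (F.lift x u) y)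

/-- The component of `v` tangent to the leaf. -/
def vert (x : M) (v : TangentSpace I x) : TangentSpace I x := v - F.lift x (F.proj x v)

/-- The transverse Levi-Civita connection on `Q`:
`∇_X s = π [X, Y_s]` for `X` tangent to the leaves and `∇_X s = π (∇^M_X Y_s)` for `X` orthogonal
to the leaves, where `Y_s = σ(s)` and `∇^M` is the Levi-Civita connection of `M`; for a general
vector `v`, the two are applied to its components (the leafwise one extended to a local section
of `T𝓕`). -/
def transverseConnection (s : Π x : M, F.Normal x) (x : M) (v : TangentSpace I x) :
    F.Normal x :=
  F.transverseLie (fun y ↦ F.vert y (FiberBundle.extend E (F.vert x v) y)) s x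
    + F.proj x (leviCivita I (fun y ↦ F.lift y (s y)) x (F.lift x (F.proj x v)))

/-- The covariant derivative `(∇_v S)(u, w) = v(S(u,w)) - S(∇_v u, w) - S(u, ∇_v w)` of a
covariant 2-tensor `S` on `Q`, where `u`, `w` are extended to smooth local sections. -/
def nablaTensor (S : Π x : M, F.Normal x → F.Normal x → ℝ) (x : M)
    (v : TangentSpace I x) (u w : F.Normal x) : ℝ :=
  mvfderiv I (fun y ↦ S y (F.extendQ u y) (F.extendQ w y)) x v
    - S x (F.transverseConnection (F.extendQ u) x v) w
    - S x u (F.transverseConnection (F.extendQ w) x v)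

/-- The transverse divergence `(div_∇ S)(u) = ∑_a (∇_{E_a} S)(E_a, u)`. -/
def div (S : Π x : M, F.Normal x → F.Normal x → ℝ) (x : M) (u : F.Normal x) : ℝ :=
  ∑ a, F.nablaTensor S x (F.lift x (F.frame x a)) (F.frame x a) u

end Single

section Maps

variable {E : Type*} [NormedAddCommGroup E] [NormedSpace ℝ E] [FiniteDimensional ℝ E]
  {H : Type*} [TopologicalSpace H] {I : ModelWithCorners ℝ E H}
  {M : Type*} [TopologicalSpace M] [ChartedSpace H M] [IsManifold I ∞ M]
  [RiemannianBundle (fun x : M ↦ TangentSpace I x)]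
  {E' : Type*} [NormedAddCommGroup E'] [NormedSpace ℝ E'] [FiniteDimensional ℝ E']
  {H' : Type*} [TopologicalSpace H'] {I' : ModelWithCorners ℝ E' H'}
  {M' : Type*} [TopologicalSpace M'] [ChartedSpace H' M'] [IsManifold I' ∞ M']
  [RiemannianBundle (fun x : M' ↦ TangentSpace I' x)]
  {q q' : ℕ} (F : SmoothFoliation I M q) (F' : SmoothFoliation I' M' q')
  (φ : M → M')

/-- A smooth foliated map: `dφ(T𝓕) ⊆ T𝓕'`. -/
def IsFoliatedMap : Prop :=
  ContMDiff I I' ∞ φ ∧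
    ∀ (x : M), ∀ v ∈ F.tangent x, mfderiv I I' φ x v ∈ F'.tangent (φ x)

/-- The transversal differential `d_T φ = π' ∘ dφ ∘ σ : Q → Q'`. -/
def dT (x : M) : F.Normal x →ₗ[ℝ] F'.Normal (φ x) :=
  F'.proj (φ x) ∘ₗ (mfderiv I I' φ x).toLinearMap ∘ₗ F.lift x

/-- The pull-back `φ^* g_{Q'}`, a covariant 2-tensor on `Q`. -/
def pullbackMetric (x : M) (u w : F.Normal x) : ℝ :=
  F'.metricQ (φ x) (F.dT F' φ x u) (F.dT F' φ x w)

/-- `|d_T φ|² = ∑_a g_{Q'}(d_T φ(E_a), d_T φ(E_a))`. -/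
def normSqDT (x : M) : ℝ :=
  ∑ a, F'.metricQ (φ x) (F.dT F' φ x (F.frame x a)) (F.dT F' φ x (F.frame x a))

/-- The transversal stress-energy tensor `S_T(φ) = ½ |d_T φ|² g_Q - φ^* g_{Q'}`. -/
def stressEnergy (x : M) (u w : F.Normal x) : ℝ :=
  1 / 2 * F.normSqDT F' φ x * F.metricQ x u w - F.pullbackMetric F' φ x u w

/-- The transverse conservation law `div_∇ S_T(φ) = 0`. -/
def ConservationLaw : Prop :=
  ∀ (x : M) (u : F.Normal x), F.div (F.stressEnergy F' φ) x u = 0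

/-- `φ` is transversally weakly conformal with conformal factor `lam²`: the function `lam²` is
basic and `φ^* g_{Q'} = lam² g_Q`. -/
def IsWeaklyConformal (lam : M → ℝ) : Prop :=
  F.IsBasic (fun x ↦ lam x ^ 2) ∧
    ∀ (x : M) (u w : F.Normal x), F.pullbackMetric F' φ x u w = lam x ^ 2 * F.metricQ x u w

/-- `φ` is transversally homothetic: `φ^* g_{Q'} = c² g_Q` for a nonzero constant `c`. -/
def IsHomothetic : Prop :=
  ∃ c : ℝ, c ≠ 0 ∧ F.IsWeaklyConformal F' φ (fun _ ↦ c)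

/-- `φ` is transversally constant: `d_T φ = 0` everywhere. -/
def IsTransversallyConstant : Prop := ∀ x : M, F.dT F' φ x = 0

end Maps

end SmoothFoliation

end

section LeviCivita
variable {E : Type*} [NormedAddCommGroup E] [NormedSpace ℝ E]
  {H : Type*} [TopologicalSpace H] {I : ModelWithCorners ℝ E H}
  {M : Type*} [TopologicalSpace M] [ChartedSpace H M] 
  [RiemannianBundle (fun x : M ↦ TangentSpace I x)]

theorem koszul_add_koszul_swap (X Y Z : Π x : M, TangentSpace I x) (x : M) :
    koszul I X Y Z x + koszul I X Z Y x = mvfderiv I (fun y ↦ inner ℝ (Y y) (Z y)) x (X x) := by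
  have hc (V W : Π x : M, TangentSpace I x) :
      (fun y ↦ inner ℝ (V y) (W y)) = fun y ↦ inner ℝ (W y) (V y) := by
    funext y
    exact real_inner_comm _ _
  simp only [koszul]
  rw [hc Z Y, hc X Z, hc Y X, VectorField.mlieBracket_swap_apply (V := X) (W := Z),
    VectorField.mlieBracket_swap_apply (V := Z) (W := Y),
    VectorField.mlieBracket_swap_apply (V := Y) (W := X)]
  simp only [inner_neg_left]
  ring

variable [IsManifold I ∞ M]
  [IsContMDiffRiemannianBundle I ∞ E (fun x : M ↦ TangentSpace I x)]

theorem mdifferentiableAt_inner {X Y : Π x : M, TangentSpace I x} {x : M}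
    (hX : MDiffAt (T% X) x) (hY : MDiffAt (T% Y) x) :
    MDiffAt (fun y ↦ (inner ℝ (X y) (Y y) : ℝ)) x :=
  MDifferentiableAt.inner_bundle (F := E) (E := fun x : M ↦ TangentSpace I x) (b := id) hX hY

variable [FiniteDimensional ℝ E]

theorem tensorialAt_koszul {X Y : Π x : M, TangentSpace I x} {x : M}
    (hX : MDiffAt (T% X) x) (hY : MDiffAt (T% Y) x) :
    TensorialAt I E (fun Z ↦ koszul I X Y Z x) x where
  smul {f Z} hf hZ := by
    have h1 : (fun y ↦ inner ℝ (Y y) ((f • Z) y)) = fun y ↦ f y * inner ℝ (Y y) (Z y) := by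
      funext y
      simp [inner_smul_right]
    have h2 : (fun y ↦ inner ℝ ((f • Z) y) (X y)) = fun y ↦ f y * inner ℝ (Z y) (X y) := by
      funext y
      simp [inner_smul_left]
    simp only [koszul]
    rw [h1, h2, mvfderiv_fun_mul hf (mdifferentiableAt_inner hY hZ), mvfderiv_fun_mul hf (mdifferentiableAt_inner hZ hX),
      VectorField.mlieBracket_smul_right hf hZ, VectorField.mlieBracket_smul_left hf hZ]
    simp [inner_add_left, inner_smul_left, inner_smul_right, real_inner_comm (Z x)]
    ring
  add {Z Z'} hZ hZ' := by
    have h1 : (fun y ↦ inner ℝ (Y y) ((Z + Z') y)) =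
        fun y ↦ inner ℝ (Y y) (Z y) + inner ℝ (Y y) (Z' y) := by
      funext y
      simp [inner_add_right]
    have h2 : (fun y ↦ inner ℝ ((Z + Z') y) (X y)) =
        fun y ↦ inner ℝ (Z y) (X y) + inner ℝ (Z' y) (X y) := by
      funext y
      simp [inner_add_left]
    simp only [koszul]
    rw [h1, h2, mvfderiv_fun_add (mdifferentiableAt_inner hY hZ) (mdifferentiableAt_inner hY hZ'),
      mvfderiv_fun_add (mdifferentiableAt_inner hZ hX) (mdifferentiableAt_inner hZ' hX),
      VectorField.mlieBracket_add_right hZ hZ', VectorField.mlieBracket_add_left hZ hZ']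
    simp [inner_add_left, inner_add_right]
    ring

theorem inner_leviCivita {Y Z : Π x : M, TangentSpace I x} {x : M}
    (hY : MDiffAt (T% Y) x) (hZ : MDiffAt (T% Z) x) (v : TangentSpace I x) :
    inner ℝ (leviCivita I Y x v) (Z x) = koszul I (FiberBundle.extend E v) Y Z x := by
  have hT := tensorialAt_koszul (FiberBundle.mdifferentiableAt_extend I E v) hY
  rw [← hT.mkHom_apply hZ]
  conv_rhs => rw [← (stdOrthonormalBasis ℝ (TangentSpace I x)).sum_repr' (Z x)]
  simp only [map_sum, map_smul, leviCivita, sum_inner, inner_smul_left, smul_eq_mul]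
  refine Finset.sum_congr rfl fun i _ ↦ ?_
  rw [TensorialAt.mkHom_apply_eq_extend]
  simp [mul_comm]

theorem mvfderiv_inner_eq_leviCivita {Y Z : Π x : M, TangentSpace I x} {x : M}
    (hY : MDiffAt (T% Y) x) (hZ : MDiffAt (T% Z) x) (v : TangentSpace I x) :
    mvfderiv I (fun y ↦ inner ℝ (Y y) (Z y)) x v =
      inner ℝ (leviCivita I Y x v) (Z x) + inner ℝ (Y x) (leviCivita I Z x v) := by
  rw [real_inner_comm (leviCivita I Z x v), inner_leviCivita hY hZ, inner_leviCivita hZ hY, koszul_add_koszul_swap]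
  simp
end LeviCivita

section Constant
variable {E : Type*} [NormedAddCommGroup E] [NormedSpace ℝ E]
  {H : Type*} [TopologicalSpace H] {I : ModelWithCorners ℝ E H} [I.Boundaryless]
  {M : Type*} [TopologicalSpace M] [ChartedSpace H M] [IsManifold I 1 M]

theorem eventually_eq_of_mvfderiv_eq_zero {f : M → ℝ} (hf : MDifferentiable I 𝓘(ℝ, ℝ) f)
    (h : ∀ x, mvfderiv I f x = 0) (x : M) : ∀ᶠ y in 𝓝 x, f y = f x := by
  obtain ⟨r, hr, hball⟩ := Metric.isOpen_iff.1 (isOpen_extChartAt_target (I := I) x) _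
    (mem_extChartAt_target x)
  have hd (z) (hz : z ∈ Metric.ball (extChartAt I x x) r) :
      HasFDerivAt (f ∘ (extChartAt I x).symm) (0 : E →L[ℝ] ℝ) z := by
    have hs : MDifferentiableAt 𝓘(ℝ, E) I (extChartAt I x).symm z := by
      have := mdifferentiableOn_extChartAt_symm (I := I) (x := x) z (hball hz)
      exact this.mdifferentiableAt ((isOpen_extChartAt_target x).mem_nhds (hball hz))
    have hm := (hf ((extChartAt I x).symm z)).comp z hs
    have : mfderiv 𝓘(ℝ, E) 𝓘(ℝ, ℝ) (f ∘ (extChartAt I x).symm) z = 0 := by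
      rw [mfderiv_comp z (hf _) hs]
      have := h ((extChartAt I x).symm z)
      ext v
      exact DFunLike.congr_fun this _
    rw [mfderiv_eq_fderiv] at this
    have hd := hm.differentiableAt.hasFDerivAt
    rwa [this] at hd
  have hc : ∀ z ∈ Metric.ball (extChartAt I x x) r, f ((extChartAt I x).symm z) = f x := by
    intro z hz
    have := (convex_ball (extChartAt I x x) r).is_const_of_fderivWithin_eq_zero (𝕜 := ℝ)
      (f := f ∘ (extChartAt I x).symm)
      (fun z hz ↦ (hd z hz).differentiableAt.differentiableWithinAt)
      (fun z hz ↦ by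
        rw [fderivWithin_of_isOpen Metric.isOpen_ball hz, (hd z hz).fderiv]) hz
      (Metric.mem_ball_self hr)
    simpa using this
  filter_upwards [(continuousAt_extChartAt (I := I) x).preimage_mem_nhds
    (Metric.ball_mem_nhds _ hr), extChartAt_source_mem_nhds (I := I) x] with y hy hys
  rw [← hc _ hy, (extChartAt I x).left_inv hys]

theorem eq_of_mvfderiv_eq_zero [PreconnectedSpace M] {f : M → ℝ}
    (hf : MDifferentiable I 𝓘(ℝ, ℝ) f) (h : ∀ x, mvfderiv I f x = 0) (x y : M) : f x = f y :=
  IsLocallyConstant.apply_eq_of_preconnectedSpace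
    ((IsLocallyConstant.iff_eventually_eq f).2 (eventually_eq_of_mvfderiv_eq_zero hf h)) x y
end Constant

noncomputable section LinearAlgebra
variable {E : Type*} [NormedAddCommGroup E] [NormedSpace ℝ E]
  {F : Type*} [NormedAddCommGroup F] [NormedSpace ℝ F]

theorem ContinuousLinearMap.isInvertible_of_injective {E' : Type*} [NormedAddCommGroup E']
    [NormedSpace ℝ E'] [FiniteDimensional ℝ E] [FiniteDimensional ℝ E'] (L : E →L[ℝ] E')
    (h : ∀ v, L v = 0 → v = 0) (hd : Module.finrank ℝ E = Module.finrank ℝ E') :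
    L.IsInvertible :=
  ⟨(LinearEquiv.ofInjectiveOfFinrankEq L.toLinearMap
    ((injective_iff_map_eq_zero L.toLinearMap).2 h) hd).toContinuousLinearEquiv, by ext; rfl⟩

/-- Precomposition with `A`, as a continuous linear map between the dual spaces. -/
def ContinuousLinearMap.dualPrecomp (A : E →L[ℝ] F) : (F →L[ℝ] ℝ) →L[ℝ] E →L[ℝ] ℝ :=
  (ContinuousLinearMap.compL ℝ E F ℝ).flip A

/-- The restriction `A G⁻¹ A*` of the cometric of `G` to covectors pulled back by `A`. -/
def cometric (G : E →L[ℝ] E →L[ℝ] ℝ) (A : E →L[ℝ] F) : (F →L[ℝ] ℝ) →L[ℝ] F :=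
  A ∘L G.inverse ∘L A.dualPrecomp

/-- The `G`-orthogonal projection onto the orthogonal complement of `ker A`,
given by `G⁻¹ A* (A G⁻¹ A*)⁻¹ A`. -/
def kerOrthogonalProj (G : E →L[ℝ] E →L[ℝ] ℝ) (A : E →L[ℝ] F) : E →L[ℝ] E :=
  G.inverse ∘L A.dualPrecomp ∘L (cometric G A).inverse ∘L A

variable [FiniteDimensional ℝ E]
  {G : E →L[ℝ] E →L[ℝ] ℝ} {A : E →L[ℝ] F}

theorem isInvertible_of_pos (hG : ∀ v, G v v = 0 → v = 0) : G.IsInvertible := by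
  refine G.isInvertible_of_injective (fun v hv ↦ hG v (by simp [hv])) ?_
  rw [← LinearMap.toContinuousLinearMap.finrank_eq, Module.finrank_linearMap_self]

theorem kerOrthogonalProj_orthogonal (hG : ∀ v, G v v = 0 → v = 0) (v : E) {k : E} (hk : A k = 0) :
    G (kerOrthogonalProj G A v) k = 0 := by
  have h1 : G (kerOrthogonalProj G A v) = A.dualPrecomp ((cometric G A).inverse (A v)) :=
    (isInvertible_of_pos hG).self_apply_inverse _
  rw [h1]
  change (cometric G A).inverse (A v) (A k) = 0
  rw [hk, map_zero]

variable [FiniteDimensional ℝ F]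

theorem isInvertible_cometric (hG : ∀ v, G v v = 0 → v = 0) (hA : Function.Surjective A) :
    (cometric G A).IsInvertible := by
  refine ContinuousLinearMap.isInvertible_of_injective _ (fun ξ hξ ↦ ?_) ?_
  · have h1 : G (G.inverse (A.dualPrecomp ξ)) = A.dualPrecomp ξ :=
      (isInvertible_of_pos hG).self_apply_inverse _
    have h2 : G.inverse (A.dualPrecomp ξ) = 0 := by
      apply hG
      rw [h1]
      change ξ (cometric G A ξ) = 0
      rw [hξ, map_zero]
    rw [h2, map_zero] at h1
    ext w
    obtain ⟨v, rfl⟩ := hA w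
    exact (DFunLike.congr_fun h1 v).symm
  · rw [← LinearMap.toContinuousLinearMap.finrank_eq, Module.finrank_linearMap_self]

theorem map_kerOrthogonalProj (hG : ∀ v, G v v = 0 → v = 0) (hA : Function.Surjective A) (v : E) :
    A (kerOrthogonalProj G A v) = A v :=
  (isInvertible_cometric hG hA).self_apply_inverse _

end LinearAlgebra

noncomputable section Coordinates
variable {E : Type*} [NormedAddCommGroup E] [NormedSpace ℝ E]
  {H : Type*} [TopologicalSpace H] {I : ModelWithCorners ℝ E H}
  {M : Type*} [TopologicalSpace M] [ChartedSpace H M]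

theorem mdifferentiableAt_clm_of_apply {D F : Type*} [NormedAddCommGroup D] [NormedSpace ℝ D]
    [FiniteDimensional ℝ D] [NormedAddCommGroup F] [NormedSpace ℝ F] {A : M → D →L[ℝ] F} {x : M}
    (h : ∀ v, MDiffAt (fun y ↦ A y v) x) : MDiffAt A x := by
  let b := Module.finBasis ℝ D
  have hA : A = fun y ↦ ∑ i, ContinuousLinearMap.smulRightL ℝ D F
      (LinearMap.toContinuousLinearMap (b.coord i)) (A y (b i)) := by
    funext y
    ext v
    conv_lhs => rw [← b.sum_repr v]
    simp only [map_sum, map_smul]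
    simp
  have hs (s : Finset (Fin (Module.finrank ℝ D))) : MDiffAt (fun y ↦ ∑ i ∈ s,
      ContinuousLinearMap.smulRightL ℝ D F
        (LinearMap.toContinuousLinearMap (b.coord i)) (A y (b i))) x := by
    induction s using Finset.cons_induction with
    | empty => simpa using mdifferentiableAt_const
    | cons i s hi ih =>
      simp only [Finset.sum_cons]
      exact ((ContinuousLinearMap.differentiableAt _).comp_mdifferentiableAt (h (b i))).add ih
  rw [hA]
  exact hs _

set_option synthInstance.maxHeartbeats 200000 in
theorem mdifferentiableAt_kerOrthogonalProj {D F : Type*} [NormedAddCommGroup D]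
    [NormedSpace ℝ D] [FiniteDimensional ℝ D] [NormedAddCommGroup F] [NormedSpace ℝ F]
    [FiniteDimensional ℝ F] {G : M → D →L[ℝ] D →L[ℝ] ℝ} {A : M → D →L[ℝ] F} {x : M}
    (hG : MDiffAt G x) (hA : MDiffAt A x) (hGx : ∀ v, G x v v = 0 → v = 0)
    (hAx : Function.Surjective (A x)) :
    MDiffAt (fun y ↦ kerOrthogonalProj (G y) (A y)) x := by
  have hGi : MDiffAt (fun y ↦ (G y).inverse) x :=
    ((isInvertible_of_pos hGx).contDiffAt_map_inverse.differentiableAt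
      one_ne_zero).comp_mdifferentiableAt hG
  have hD : MDiffAt (fun y ↦ (A y).dualPrecomp) x :=
    (ContinuousLinearMap.compL ℝ D F ℝ).flip.differentiableAt.comp_mdifferentiableAt hA
  have hN : MDiffAt (fun y ↦ cometric (G y) (A y)) x := hA.clm_comp (hGi.clm_comp hD)
  have hNi : MDiffAt (fun y ↦ (cometric (G y) (A y)).inverse) x :=
    ((isInvertible_cometric hGx hAx).contDiffAt_map_inverse.differentiableAt
      one_ne_zero).comp_mdifferentiableAt (f := fun y ↦ cometric (G y) (A y)) hN
  exact hGi.clm_comp (hD.clm_comp (hNi.clm_comp hA))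

variable [IsManifold I ∞ M]

/-- The inverse of the preferred trivialization of the tangent bundle at `x`. -/
abbrev tangentCoord (I : ModelWithCorners ℝ E H) [IsManifold I ∞ M] (x y : M) :
    E →L[ℝ] TangentSpace I y :=
  (trivializationAt E (TangentSpace I) x).symmL ℝ y

theorem mdifferentiableAt_tangentCoord (x : M) (v : E) :
    MDiffAt (T% fun y ↦ tangentCoord I x y v) x := by
  rw [mdifferentiableAt_section]
  refine (mdifferentiableAt_const (c := v)).congr_of_eventuallyEq ?_
  filter_upwards [(trivializationAt E (TangentSpace I) x).open_baseSet.mem_nhds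
    (FiberBundle.mem_baseSet_trivializationAt E (TangentSpace I) x)] with y hy
  rw [Trivialization.symmL_apply _ hy, Trivialization.apply_mk_symm _ hy]

theorem mdifferentiableAt_mvfderiv_comp_tangentCoord {F : Type*} [NormedAddCommGroup F]
    [NormedSpace ℝ F] {f : M → F} {x : M} (hf : ContMDiffAt I 𝓘(ℝ, F) ∞ f x) :
    MDiffAt (fun y ↦ mvfderiv I f y ∘L tangentCoord I x y) x := by
  have h := (hf.mfderiv_const (m := 1)
    (by rw [one_add_one_eq_two]; exact ENat.LEInfty.out)).mdifferentiableAt one_ne_zero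
  refine h.congr_of_eventuallyEq (Filter.Eventually.of_forall fun y ↦ ?_)
  ext v
  simp [inTangentCoordinates, ContinuousLinearMap.inCoordinates, mvfderiv]
  rfl

theorem eventually_extend_zero_eq_zero (x : M) :
    ∀ᶠ y in 𝓝 x, FiberBundle.extend E (0 : TangentSpace I x) y = 0 := by
  have h : (trivializationAt E (TangentSpace I) x ⟨x, (0 : TangentSpace I x)⟩).2 = 0 :=
    congrArg Prod.snd ((trivializationAt E (TangentSpace I) x).zeroSection ℝ
      (FiberBundle.mem_baseSet_trivializationAt E (TangentSpace I) x))
  filter_upwards [(trivializationAt E (TangentSpace I) x).open_baseSet.mem_nhds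
    (FiberBundle.mem_baseSet_trivializationAt E (TangentSpace I) x)] with y hy
  rw [FiberBundle.extend, h, ← Trivialization.symmL_apply (R := ℝ) _ hy, map_zero]

end Coordinates

namespace SmoothFoliation
variable {E : Type*} [NormedAddCommGroup E] [NormedSpace ℝ E]
  {H : Type*} [TopologicalSpace H] {I : ModelWithCorners ℝ E H}
  {M : Type*} [TopologicalSpace M] [ChartedSpace H M]
  {q : ℕ} (F : SmoothFoliation I M q)

theorem proj_eq_zero_iff (x : M) (v : TangentSpace I x) : F.proj x v = 0 ↔ v ∈ F.tangent x :=
  Submodule.Quotient.mk_eq_zero _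

variable [FiniteDimensional ℝ E] [RiemannianBundle (fun x : M ↦ TangentSpace I x)]

theorem lift_mem_orthogonal (x : M) (u : F.Normal x) : F.lift x u ∈ (F.tangent x)ᗮ :=
  Subtype.mem _

theorem proj_lift (x : M) (u : F.Normal x) : F.proj x (F.lift x u) = u :=
  (Submodule.quotientEquivOfIsCompl (F.tangent x) (F.tangent x)ᗮ
      (Submodule.isCompl_orthogonal _)).symm_apply_apply u

theorem lift_proj_of_mem_orthogonal (x : M) {v : TangentSpace I x} (hv : v ∈ (F.tangent x)ᗮ) :
    F.lift x (F.proj x v) = v :=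
  congrArg Subtype.val ((Submodule.quotientEquivOfIsCompl (F.tangent x) (F.tangent x)ᗮ
      (Submodule.isCompl_orthogonal _)).apply_symm_apply ⟨v, hv⟩)

theorem lift_injective (x : M) : Function.Injective (F.lift x) :=
  Function.LeftInverse.injective (F.proj_lift x)

theorem metricQ_proj_left (x : M) (v : TangentSpace I x) (w : F.Normal x) :
    F.metricQ x (F.proj x v) w = inner ℝ v (F.lift x w) := by
  have h : v - F.lift x (F.proj x v) ∈ F.tangent x := by
    rw [← proj_eq_zero_iff, map_sub, proj_lift, sub_self]
  have := Submodule.inner_right_of_mem_orthogonal h (F.lift_mem_orthogonal x w)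
  rw [inner_sub_left, sub_eq_zero] at this
  exact this.symm

theorem metricQ_comm (x : M) (u w : F.Normal x) : F.metricQ x u w = F.metricQ x w u :=
  real_inner_comm _ _

theorem metricQ_self_eq_zero (x : M) {u : F.Normal x} (h : F.metricQ x u u = 0) : u = 0 :=
  F.lift_injective x ((inner_self_eq_zero (𝕜 := ℝ).1 h).trans (map_zero _).symm)

variable [IsManifold I ∞ M]
  [IsContMDiffRiemannianBundle I ∞ E (fun x : M ↦ TangentSpace I x)]

theorem mdifferentiableAt_lift_proj {V : Π x : M, TangentSpace I x} {x : M}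
    (hV : MDiffAt (T% V) x) : MDiffAt (T% fun y ↦ F.lift y (F.proj y (V y))) x := by
  obtain ⟨U, hU, hxU, f, hf, hker⟩ := F.exists_submersion x
  obtain ⟨g, -, hg⟩ := IsContMDiffRiemannianBundle.exists_contMDiff (IB := I) (n := ∞) (F := E)
    (E := fun x : M ↦ TangentSpace I x)
  let e := trivializationAt E (TangentSpace I) x
  let G (y : M) : E →L[ℝ] E →L[ℝ] ℝ :=
    (g y).bilinearComp (tangentCoord I x y) (tangentCoord I x y)
  let A (y : M) : E →L[ℝ] EuclideanSpace ℝ (Fin q) := mvfderiv I f y ∘L tangentCoord I x y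
  have hbase : ∀ᶠ y in 𝓝 x, y ∈ e.baseSet := e.open_baseSet.mem_nhds
    (FiberBundle.mem_baseSet_trivializationAt E (TangentSpace I) x)
  have hG : MDiffAt G x := by
    refine mdifferentiableAt_clm_of_apply fun v ↦ mdifferentiableAt_clm_of_apply fun w ↦ ?_
    have := mdifferentiableAt_inner (mdifferentiableAt_tangentCoord (I := I) x v)
      (mdifferentiableAt_tangentCoord (I := I) x w)
    exact this.congr_of_eventuallyEq (.of_forall fun y ↦ (hg y _ _).symm)
  have hA : MDiffAt A x :=
    mdifferentiableAt_mvfderiv_comp_tangentCoord (hf.contMDiffAt (hU.mem_nhds hxU))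
  have hcoord {y : M} (hy : y ∈ e.baseSet) (v : TangentSpace I y) :
      tangentCoord I x y (e ⟨y, v⟩).2 = v := by
    rw [Trivialization.symmL_apply _ hy]
    exact e.symm_proj_apply ⟨y, v⟩ hy
  have hcoord' {y : M} (hy : y ∈ e.baseSet) (v : E) :
      (e ⟨y, tangentCoord I x y v⟩).2 = v := by
    rw [Trivialization.symmL_apply _ hy, Trivialization.apply_mk_symm _ hy]
  have hGpos {y : M} (hy : y ∈ e.baseSet) (v : E) (hv : G y v v = 0) : v = 0 := by
    have h0 : tangentCoord I x y v = 0 :=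
      inner_self_eq_zero (𝕜 := ℝ).1 ((hg y _ _).trans hv)
    rw [← hcoord' hy v, h0, ← hcoord' hy 0, map_zero]
  have hAsurj {y : M} (hy : y ∈ e.baseSet) (hyU : y ∈ U) : Function.Surjective (A y) := by
    intro w
    obtain ⟨v, rfl⟩ := (hker y hyU).1 w
    exact ⟨(e ⟨y, v⟩).2, congrArg (mvfderiv I f y) (hcoord hy v)⟩
  have hP := mdifferentiableAt_kerOrthogonalProj hG hA (hGpos hbase.self_of_nhds)
    (hAsurj hbase.self_of_nhds hxU)
  rw [mdifferentiableAt_section] at hV ⊢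
  refine (hP.clm_apply hV).congr_of_eventuallyEq ?_
  filter_upwards [hbase, hU.mem_nhds hxU] with y hy hyU
  set w := kerOrthogonalProj (G y) (A y) (e ⟨y, V y⟩).2 with hw
  have hAw : mvfderiv I f y (tangentCoord I x y w) = mvfderiv I f y (V y) := by
    have := map_kerOrthogonalProj (hGpos hy) (hAsurj hy hyU) (e ⟨y, V y⟩).2
    rw [← hw] at this
    refine this.trans (congrArg (mvfderiv I f y) (hcoord hy _))
  have horth : tangentCoord I x y w ∈ (F.tangent y)ᗮ := by
    rw [Submodule.mem_orthogonal']
    intro k hk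
    rw [hg, ← hcoord hy k]
    refine kerOrthogonalProj_orthogonal (hGpos hy) _ ?_
    exact (congrArg (mvfderiv I f y) (hcoord hy k)).trans (((hker y hyU).2 k).1 hk)
  have hproj : F.proj y (V y) = F.proj y (tangentCoord I x y w) := by
    rw [← sub_eq_zero, ← map_sub, proj_eq_zero_iff, (hker y hyU).2, map_sub, hAw, sub_self]
  rw [hproj, F.lift_proj_of_mem_orthogonal y horth]
  exact hcoord' hy w

end SmoothFoliation

namespace SmoothFoliation

section Single
variable {E : Type*} [NormedAddCommGroup E] [NormedSpace ℝ E]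
  {H : Type*} [TopologicalSpace H] {I : ModelWithCorners ℝ E H}
  {M : Type*} [TopologicalSpace M] [ChartedSpace H M]
  {q : ℕ} (F : SmoothFoliation I M q)

theorem isBasic_const (c : ℝ) : F.IsBasic (fun _ ↦ c) :=
  ⟨contMDiff_const, fun x v _ ↦ by rw [mvfderiv_const]; rfl⟩

variable [FiniteDimensional ℝ E] [RiemannianBundle (fun x : M ↦ TangentSpace I x)]

theorem finrank_orthogonal_tangent (x : M) : Module.finrank ℝ (F.tangent x)ᗮ = q := by
  obtain ⟨U, -, hxU, f, -, hker⟩ := F.exists_submersion x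
  have hk : (mvfderiv I f x).ker = F.tangent x := by
    ext v
    exact ((hker x hxU).2 v).symm
  have h1 := LinearMap.finrank_range_add_finrank_ker (mvfderiv I f x).toLinearMap
  rw [LinearMap.range_eq_top.2 (hker x hxU).1, finrank_top, finrank_euclideanSpace_fin, hk] at h1
  have h2 := Submodule.finrank_add_finrank_orthogonal (F.tangent x)
  omega

theorem lift_frame (x : M) (a : Fin (Module.finrank ℝ (F.tangent x)ᗮ)) :
    F.lift x (F.frame x a) = stdOrthonormalBasis ℝ (F.tangent x)ᗮ a :=
  F.lift_proj_of_mem_orthogonal x (Subtype.mem _)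

theorem metricQ_frame_self (x : M) (a : Fin (Module.finrank ℝ (F.tangent x)ᗮ)) :
    F.metricQ x (F.frame x a) (F.frame x a) = 1 := by
  rw [metricQ, lift_frame, ← Submodule.coe_inner, real_inner_self_eq_norm_sq,
    OrthonormalBasis.norm_eq_one, one_pow]

theorem sum_metricQ_frame_smul (x : M) (u : F.Normal x) :
    ∑ a, F.metricQ x (F.frame x a) u • F.lift x (F.frame x a) = F.lift x u := by
  have h := congrArg Subtype.val ((stdOrthonormalBasis ℝ (F.tangent x)ᗮ).sum_repr'
    ⟨F.lift x u, F.lift_mem_orthogonal x u⟩)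
  rw [Submodule.coe_sum] at h
  refine Eq.trans (Finset.sum_congr rfl fun a _ ↦ ?_) h
  rw [metricQ, lift_frame]
  rfl

theorem IsBasic.mvfderiv_eq_zero {F : SmoothFoliation I M q} {f : M → ℝ} (hf : F.IsBasic f) {x : M}
    (h : ∀ u, F.dBasic f x u = 0) : mvfderiv I f x = 0 := by
  ext v
  have hv : v - F.lift x (F.proj x v) ∈ F.tangent x := by
    rw [← proj_eq_zero_iff, map_sub, proj_lift, sub_self]
  have := hf.2 x _ hv
  rw [map_sub, sub_eq_zero] at this
  exact this.trans (h _)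

variable [IsManifold I ∞ M]

theorem extendQ_self {x : M} (u : F.Normal x) : F.extendQ u x = u := by
  rw [extendQ, FiberBundle.extend_apply_self, proj_lift]

theorem transverseConnection_lift (s : Π x : M, F.Normal x) (x : M) (e : F.Normal x) :
    F.transverseConnection s x (F.lift x e) =
      F.proj x (leviCivita I (fun y ↦ F.lift y (s y)) x (F.lift x e)) := by
  have h0 : (fun y ↦ F.vert y (FiberBundle.extend E (F.vert x (F.lift x e)) y)) =ᶠ[𝓝 x] 0 := by
    have hv : F.vert x (F.lift x e) = 0 := by rw [vert, proj_lift, sub_self]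
    filter_upwards [eventually_extend_zero_eq_zero (I := I) x] with y hy
    rw [hv, hy, vert, map_zero, map_zero, sub_zero]
    rfl
  have hlie : F.transverseLie
      (fun y ↦ F.vert y (FiberBundle.extend E (F.vert x (F.lift x e)) y)) s x = 0 :=
    (congrArg (F.proj x) ((h0.mlieBracket_vectorField_eq Filter.EventuallyEq.rfl).trans
      (congrFun VectorField.mlieBracket_zero_left x))).trans (map_zero _)
  rw [transverseConnection, hlie, zero_add, proj_lift]

variable [IsContMDiffRiemannianBundle I ∞ E (fun x : M ↦ TangentSpace I x)]

theorem mdifferentiableAt_lift_extendQ {x : M} (u : F.Normal x) :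
    MDiffAt (T% fun y ↦ F.lift y (F.extendQ u y)) x :=
  F.mdifferentiableAt_lift_proj (FiberBundle.mdifferentiableAt_extend I E (F.lift x u))

theorem mdifferentiableAt_metricQ_extendQ {x : M} (u w : F.Normal x) :
    MDiffAt (fun y ↦ F.metricQ y (F.extendQ u y) (F.extendQ w y)) x :=
  mdifferentiableAt_inner (F.mdifferentiableAt_lift_extendQ u) (F.mdifferentiableAt_lift_extendQ w)

theorem mvfderiv_metricQ_extendQ {x : M} (e u w : F.Normal x) :
    mvfderiv I (fun y ↦ F.metricQ y (F.extendQ u y) (F.extendQ w y)) x (F.lift x e) =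
      F.metricQ x (F.transverseConnection (F.extendQ u) x (F.lift x e)) w
        + F.metricQ x u (F.transverseConnection (F.extendQ w) x (F.lift x e)) := by
  have h := mvfderiv_inner_eq_leviCivita (F.mdifferentiableAt_lift_extendQ u)
    (F.mdifferentiableAt_lift_extendQ w) (F.lift x e)
  rw [F.metricQ_comm x u, transverseConnection_lift, transverseConnection_lift, metricQ_proj_left,
    metricQ_proj_left, real_inner_comm (F.lift x u)]
  simp only [extendQ_self] at h
  exact h

theorem nablaTensor_smul_metricQ {f : M → ℝ} {x : M} (hf : MDiffAt f x) (e u w : F.Normal x) :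
    F.nablaTensor (fun y u w ↦ f y * F.metricQ y u w) x (F.lift x e) u w =
      mvfderiv I f x (F.lift x e) * F.metricQ x u w := by
  rw [nablaTensor, mvfderiv_fun_mul hf (F.mdifferentiableAt_metricQ_extendQ u w)]
  simp only [add_apply, smul_apply, smul_eq_mul, mvfderiv_metricQ_extendQ]
  rw [extendQ_self, extendQ_self]
  ring

theorem div_smul_metricQ {f : M → ℝ} {x : M} (hf : MDiffAt f x) (u : F.Normal x) :
    F.div (fun y u w ↦ f y * F.metricQ y u w) x u = F.dBasic f x u := by
  rw [dBasic, ← F.sum_metricQ_frame_smul x u, map_sum, div]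
  refine Finset.sum_congr rfl fun a _ ↦ ?_
  rw [F.nablaTensor_smul_metricQ hf, map_smul, smul_eq_mul, mul_comm]

end Single

section Maps
variable {E : Type*} [NormedAddCommGroup E] [NormedSpace ℝ E] [FiniteDimensional ℝ E]
  {H : Type*} [TopologicalSpace H] {I : ModelWithCorners ℝ E H}
  {M : Type*} [TopologicalSpace M] [ChartedSpace H M]
  [RiemannianBundle (fun x : M ↦ TangentSpace I x)]
  {E' : Type*} [NormedAddCommGroup E'] [NormedSpace ℝ E'] [FiniteDimensional ℝ E']
  {H' : Type*} [TopologicalSpace H'] {I' : ModelWithCorners ℝ E' H'}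
  {M' : Type*} [TopologicalSpace M'] [ChartedSpace H' M']
  [RiemannianBundle (fun x : M' ↦ TangentSpace I' x)]
  {q q' : ℕ} {F : SmoothFoliation I M q} {F' : SmoothFoliation I' M' q'}
  {φ : M → M'} {lam : M → ℝ}

theorem IsWeaklyConformal.normSqDT_eq (h : F.IsWeaklyConformal F' φ lam) (x : M) :
    F.normSqDT F' φ x = q * lam x ^ 2 := by
  have ha (a) : F'.metricQ (φ x) (F.dT F' φ x (F.frame x a)) (F.dT F' φ x (F.frame x a)) =
      lam x ^ 2 :=
    (h.2 x _ _).trans (by rw [metricQ_frame_self, mul_one])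
  simp only [normSqDT, ha]
  simp [finrank_orthogonal_tangent]

theorem IsWeaklyConformal.stressEnergy_eq (h : F.IsWeaklyConformal F' φ lam) :
    F.stressEnergy F' φ =
      fun x u w ↦ (((q : ℝ) - 2) / 2 * lam x ^ 2) * F.metricQ x u w := by
  funext x u w
  rw [stressEnergy, h.normSqDT_eq, h.2]
  ring

theorem IsWeaklyConformal.isHomothetic_iff [Nonempty M] (hq : 0 < q)
    (h : F.IsWeaklyConformal F' φ lam) (hφ : ¬ F.IsTransversallyConstant F' φ) :
    F.IsHomothetic F' φ ↔ ∃ c : ℝ, ∀ x : M, lam x ^ 2 = c := by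
  constructor
  · rintro ⟨c, -, hc⟩
    refine ⟨c ^ 2, fun x ↦ ?_⟩
    have hpos : 0 < Module.finrank ℝ (F.tangent x)ᗮ := by rwa [F.finrank_orthogonal_tangent x]
    have := (h.2 x _ _).symm.trans (hc.2 x (F.frame x ⟨0, hpos⟩) (F.frame x ⟨0, hpos⟩))
    rwa [metricQ_frame_self, mul_one, mul_one] at this
  · rintro ⟨c, hc⟩
    obtain ⟨x₀⟩ := (inferInstance : Nonempty M)
    refine ⟨lam x₀, fun h0 ↦ hφ fun x ↦ LinearMap.ext fun u ↦ ?_,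
      F.isBasic_const _, fun x u w ↦ by rw [h.2, hc x, hc x₀]⟩
    refine F'.metricQ_self_eq_zero _ ((h.2 x u u).trans ?_)
    rw [hc x, ← hc x₀, h0]
    ring

variable [IsManifold I ∞ M]
  [IsContMDiffRiemannianBundle I ∞ E (fun x : M ↦ TangentSpace I x)]

theorem IsWeaklyConformal.div_stressEnergy
    (h : F.IsWeaklyConformal F' φ lam) (x : M) (u : F.Normal x) :
    F.div (F.stressEnergy F' φ) x u =
      ((q : ℝ) - 2) / 2 * F.dBasic (fun y ↦ lam y ^ 2) x u := by
  have hd : MDiffAt (fun y ↦ lam y ^ 2) x := h.1.1.contMDiffAt.mdifferentiableAt (by simp)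
  have hc : MDiffAt (fun _ : M ↦ ((q : ℝ) - 2) / 2) x := mdifferentiableAt_const
  rw [h.stressEnergy_eq,
    F.div_smul_metricQ (f := fun y ↦ ((q : ℝ) - 2) / 2 * lam y ^ 2) (hc.mul hd), dBasic, dBasic,
    mvfderiv_fun_mul hc hd, mvfderiv_const]
  simp

theorem IsWeaklyConformal.conservationLaw_iff [I.Boundaryless] [ConnectedSpace M] (hq : q ≠ 2) (h : F.IsWeaklyConformal F' φ lam) :
    F.ConservationLaw F' φ ↔ ∃ c : ℝ, ∀ x : M, lam x ^ 2 = c := by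
  have hq' : ((q : ℝ) - 2) / 2 ≠ 0 :=
    div_ne_zero (sub_ne_zero.2 (mod_cast hq)) two_ne_zero
  constructor
  · intro hcl
    obtain ⟨x₀⟩ := (inferInstance : Nonempty M)
    refine ⟨lam x₀ ^ 2, fun x ↦ eq_of_mvfderiv_eq_zero (I := I) (f := fun y ↦ lam y ^ 2)
      (h.1.1.mdifferentiable (by simp)) (fun y ↦ h.1.mvfderiv_eq_zero fun u ↦ ?_) x x₀⟩
    have := hcl y u
    rw [h.div_stressEnergy] at this
    exact (mul_eq_zero.1 this).resolve_left hq'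
  · rintro ⟨c, hc⟩ x u
    rw [h.div_stressEnergy, funext hc, dBasic, mvfderiv_const]
    simp

end Maps
end SmoothFoliation

theorem proposition5p5
    {E : Type*} [NormedAddCommGroup E] [NormedSpace ℝ E] [FiniteDimensional ℝ E]
    {H : Type*} [TopologicalSpace H] {I : ModelWithCorners ℝ E H} [I.Boundaryless]
    {M : Type*} [TopologicalSpace M] [ChartedSpace H M] [IsManifold I ∞ M] [ConnectedSpace M]
    [RiemannianBundle (fun x : M ↦ TangentSpace I x)]
    [IsContMDiffRiemannianBundle I ∞ E (fun x : M ↦ TangentSpace I x)]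
    {E' : Type*} [NormedAddCommGroup E'] [NormedSpace ℝ E'] [FiniteDimensional ℝ E']
    {H' : Type*} [TopologicalSpace H'] {I' : ModelWithCorners ℝ E' H'} [I'.Boundaryless]
    {M' : Type*} [TopologicalSpace M'] [ChartedSpace H' M'] [IsManifold I' ∞ M']
    [RiemannianBundle (fun x : M' ↦ TangentSpace I' x)]
    [IsContMDiffRiemannianBundle I' ∞ E' (fun x : M' ↦ TangentSpace I' x)]
    {q q' : ℕ} (hq : 2 < q)
    (F : SmoothFoliation I M q) (hF : F.IsBundleLike)
    (F' : SmoothFoliation I' M' q') (hF' : F'.IsBundleLike)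
    (φ : M → M') (hφ : F.IsFoliatedMap F' φ)
    (lam : M → ℝ) (hconf : F.IsWeaklyConformal F' φ lam) :
    (∀ (x : M) (u : F.Normal x),
      F.div (F.stressEnergy F' φ) x u = ((q : ℝ) - 2) / 2 * F.dBasic (fun y ↦ lam y ^ 2) x u) ∧
    (F.ConservationLaw F' φ ↔ ∃ c : ℝ, ∀ x : M, lam x ^ 2 = c) ∧
    (¬ F.IsTransversallyConstant F' φ → (F.IsHomothetic F' φ ↔ F.ConservationLaw F' φ)) := by
  have hcl := hconf.conservationLaw_iff hq.ne'
  exact ⟨hconf.div_stressEnergy, hcl,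
    fun hnc ↦ (hconf.isHomothetic_iff (by omega) hnc).trans hcl.symm⟩
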